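/- For every dimension $n$ there is a constant $c_n>0$, depending only on $n$, such that the following holds. Let $\mathcal X$ be a set, $\mathcal Y$ a finite set of classes, and $h:\mathcal X\to\mathcal Y$ a labelling in which every class is non-empty. For $f:\mathcal X\to\mathbb R^n$ and $i\in\mathcal Y$ put $X_f^i=\{f(x) : h(x)=i\}$. Call $f$ triplet-separated if $\|x-y\|\le\|x-z\|$ for all $i\ne j$, all $x,y\in X_f^i$ and all $z\in X_f^j$, and let $\mathcal F_{TS}$ be the set of all triplet-separated functions $\mathcal X\to\mathbb R^n$. For $f,g:\mathcal X\to\mathbb R^n$ define, with values in $[0,\infty]$, $$d_{\mathrm{haus}}(f,g)=\max_{i\in\mathcal Y} d_H(X_f^i,X_g^i),\qquad d_{\mathrm{iso}}(f,g)=\sup_{x_1,x_2\in\mathcal X}\bigl|\,\|f(x_1)-f(x_2)\|-\|g(x_1)-g(x_2)\|\,\bigr|,$$ where $d_H$ is the Hausdorff distance, and $d_\bullet(f,\mathcal F_{TS})=\inf_{g\in\mathcal F_{TS}}d_\bullet(f,g)$ for $\bullet\in\{\mathrm{haus},\mathrm{iso}\}$. The thickness of a bounded set $A\subset\mathbb R^n$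 is $\theta(A)=\inf_{\|e\|=1}\operatorname{diam}\{x\cdot e : x\in A\}$. Let $\theta_*>0$ and $D$ be real numbers. Then for every $f_\theta:\mathcal X\to\mathbb R^n$ whose image is bounded, has diameter at most $D$ and has thickness $\theta(f_\theta(\mathcal X))\ge\theta_*$, $$d_{\mathrm{haus}}(f_\theta,\mathcal F_{TS})\le \frac{c_n D}{\theta_*}\,d_{\mathrm{iso}}(f_\theta,\mathcal F_{TS})\qquad\text{and}\qquad d_{\mathrm{iso}}(f_\theta,\mathcal F_{TS})\le 2\,d_{\mathrm{haus}}(f_\theta,\mathcal F_{TS}).$$ In particular, for embeddings normalized to have image of diameter at most $1$, the first constant is $c_n/\theta_*$. -/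

import Mathlib

open scoped ENNReal

noncomputable section

namespace TripletEmbedding

/-- The set `X_f^i = {f x | h x = i}` of embeddings of the data points of class `i`. -/
def classSet {X Y E : Type*} (h : X → Y) (f : X → E) (i : Y) : Set E :=
  f '' {x | h x = i}

/-- A family of non-empty subsets is triplet-separated if, for `i ≠ j`, every point of the
`i`-th set is at least as close to all points of the `i`-th set as to any point of the `j`-th. -/
def IsTripletSeparated {ι : Type*} {n : ℕ} (A : ι → Set (EuclideanSpace ℝ (Fin n))) : Prop :=
  (∀ i, (A i).Nonempty) ∧
    ∀ i j, i ≠ j → ∀ x ∈ A i, ∀ y ∈ A i, ∀ z ∈ A j, ‖x - y‖ ≤ ‖x - z‖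

/-- The set of all triplet-separated functions `X → ℝⁿ`. -/
def tripletSeparated {X Y : Type*} (h : X → Y) (n : ℕ) : Set (X → EuclideanSpace ℝ (Fin n)) :=
  {f | IsTripletSeparated (classSet h f)}

/-- The thickness of a bounded set: the infimum over all unit vectors `e` of the diameter of the
image of the set under `x ↦ x · e`. -/
def thickness {n : ℕ} (A : Set (EuclideanSpace ℝ (Fin n))) : ℝ :=
  ⨅ e : Metric.sphere (0 : EuclideanSpace ℝ (Fin n)) 1,
    Metric.diam ((fun x => inner ℝ x (e : EuclideanSpace ℝ (Fin n))) '' A)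

/-- The Hausdorff-like distance: the largest (over the classes) Hausdorff distance between the
class-embedding sets. It takes values in `[0, ∞]`. -/
def dHaus {X Y : Type*} {n : ℕ} (h : X → Y) (f g : X → EuclideanSpace ℝ (Fin n)) : ℝ≥0∞ :=
  ⨆ i : Y, Metric.hausdorffEDist (classSet h f i) (classSet h g i)

/-- The isometric error, with values in `[0, ∞]`. -/
def dIso {X : Type*} {n : ℕ} (f g : X → EuclideanSpace ℝ (Fin n)) : ℝ≥0∞ :=
  ⨆ (x₁ : X) (x₂ : X), ENNReal.ofReal |‖f x₁ - f x₂‖ - ‖g x₁ - g x₂‖|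

/-- The Hausdorff-like distance from a function to a set of functions. -/
def dHausSet {X Y : Type*} {n : ℕ} (h : X → Y) (f : X → EuclideanSpace ℝ (Fin n))
    (F : Set (X → EuclideanSpace ℝ (Fin n))) : ℝ≥0∞ :=
  ⨅ g ∈ F, dHaus h f g

/-- The isometric error from a function to a set of functions. -/
def dIsoSet {X : Type*} {n : ℕ} (f : X → EuclideanSpace ℝ (Fin n))
    (F : Set (X → EuclideanSpace ℝ (Fin n))) : ℝ≥0∞ :=
  ⨅ g ∈ F, dIso f g

end TripletEmbedding

end

/-!
The second inequality moves every point `g x` of a triplet-separated `g` inside its class set, to a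
point near `f x` (`dIsoSet_le_of_dHaus_lt`): triplet separation survives, and a pointwise error `r`
changes distances by at most `2 * r`.

The first inequality is an isometric approximation theorem for thick sets,
`exists_linearIsometry_of_abs_norm_sub_le`: if `g` reproduces the distances of `f` up to `δ`, then a
rigid motion brings `g` within `O(D * δ / θ)` of `f`, and rigid motions preserve triplet separation.
To prove it, subtract the values at a base point to get `u` and `v`; by polarization their Gram
matrices differ entrywise by `ε = O(D * δ)` (`abs_inner_sub_inner_le_of_abs_norm_sub_le`; for `δ > D`
the claim is trivial). Among the `u x` choose `n` points spanning nearly maximal volume: by Cramer's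
rule all `u x` are combinations of them with bounded coefficients, and thickness bounds the map `M`
they define below by a multiple of `θ` (`exists_frame_of_forall_exists_le_abs_inner`). Let `N` be the
map defined by the corresponding `v x`.

* Comparing polar decompositions gives an isometry `U` with `‖U N - M‖ = O(ε / θ)`
  (`exists_linearIsometry_norm_sub_le`). That it takes no smallness of `ε` is what makes the
  estimate linear in `1 / θ` for all `ε`.
* If `u x = M c`, then `v x - N c` has norm `O(√ε)` and inner products `O(ε)` with the columns of `N`.
  Either `N` is bounded below by a multiple of `θ`, or `θ² = O(ε)`; in both cases
  `v x - N c = O(ε / θ)` (`norm_le_of_nearly_orthogonal`).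
-/

open scoped ENNReal
open Module

/-! ### Aligning two linear maps with nearby quadratic forms -/

section Procrustes

variable {V : Type*} [NormedAddCommGroup V] [InnerProductSpace ℝ V] [FiniteDimensional ℝ V]

/-- Two endomorphisms with the same norms differ by a linear isometry, even if they are singular. -/
theorem exists_linearIsometry_comp_eq (A B : V →ₗ[ℝ] V) (hAB : ∀ x, ‖A x‖ = ‖B x‖) :
    ∃ U : V →ₗᵢ[ℝ] V, ∀ x, U (A x) = B x := by
  obtain ⟨r, hr⟩ := A.rangeRestrict.exists_rightInverse_of_surjective A.range_rangeRestrict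
  have hr' : ∀ y : LinearMap.range A, A (r y) = y := fun y => by
    have := LinearMap.congr_fun hr y
    simpa using congrArg Subtype.val this
  let L : LinearMap.range A →ₗᵢ[ℝ] V :=
    { toLinearMap := B ∘ₗ r
      norm_map' := fun y => by
        rw [LinearMap.comp_apply, ← hAB, hr' y]; rfl }
  refine ⟨L.extend, fun x => ?_⟩
  have h1 := L.extend_apply ⟨A x, LinearMap.mem_range_self A x⟩
  refine h1.trans ?_
  have h2 : ‖B (r ⟨A x, LinearMap.mem_range_self A x⟩ - x)‖ = 0 := by
    rw [← hAB, map_sub, hr']; simp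
  rw [norm_eq_zero, map_sub, sub_eq_zero] at h2
  exact h2

/-- The symmetric factor of the polar decomposition, `P = √(T* T)`: it has the same norms as `T` and
is bounded below, as a quadratic form, by any lower bound `s` of `T`. With `s = 0` this says that
`P` is positive semidefinite. -/
theorem exists_isSymmetric_norm_eq (T : V →ₗ[ℝ] V) :
    ∃ P : V →ₗ[ℝ] V, P.IsSymmetric ∧ (∀ x, ‖P x‖ = ‖T x‖) ∧
      ∀ s : ℝ, (∀ x, s * ‖x‖ ≤ ‖T x‖) → ∀ x, s * ‖x‖ ^ 2 ≤ inner ℝ (P x) x := by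
  have hS := LinearMap.isSymmetric_adjoint_mul_self T
  set b := hS.eigenvectorBasis rfl
  set l := hS.eigenvalues rfl
  have hTT : ∀ x y, inner ℝ (T x) (T y) = inner ℝ ((T.adjoint * T) x) y := fun x y => by
    rw [Module.End.mul_apply, LinearMap.adjoint_inner_left]
  have happ : ∀ i, (T.adjoint * T) (b i) = l i • b i := fun i =>
    hS.apply_eigenvectorBasis rfl i
  have hlT : ∀ i, l i = ‖T (b i)‖ ^ 2 := fun i => by
    rw [← real_inner_self_eq_norm_sq, hTT, happ, inner_smul_left, real_inner_self_eq_norm_sq]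
    simp
  have hTsq : ∀ x, ‖T x‖ ^ 2 = ∑ i, ‖T (b i)‖ ^ 2 * inner ℝ (b i) x ^ 2 := fun x => by
    rw [← real_inner_self_eq_norm_sq, hTT, ← b.sum_inner_mul_inner]
    refine Finset.sum_congr rfl fun i _ => ?_
    rw [hS x (b i), happ, inner_smul_right, real_inner_comm x (b i), hlT]
    ring
  let P : V →ₗ[ℝ] V := ∑ i, ‖T (b i)‖ • (innerₛₗ ℝ (b i)).smulRight (b i)
  have hP : ∀ x i, inner ℝ (b i) (P x) = ‖T (b i)‖ * inner ℝ (b i) x := fun x i => by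
    simp [P, LinearMap.sum_apply, inner_sum, inner_smul_right, b.inner_eq_ite]
  have hPxy : ∀ x y, inner ℝ (P x) y = ∑ i, ‖T (b i)‖ * (inner ℝ (b i) x * inner ℝ (b i) y) :=
    fun x y => by
      rw [← b.sum_inner_mul_inner]
      refine Finset.sum_congr rfl fun i _ => ?_
      rw [real_inner_comm, hP]; ring
  refine ⟨P, fun x y => ?_, fun x => ?_, fun s hs x => ?_⟩
  · rw [hPxy, real_inner_comm, hPxy]
    exact Finset.sum_congr rfl fun i _ => by ring
  · rw [← sq_eq_sq₀ (norm_nonneg _) (norm_nonneg _), hTsq, ← b.sum_sq_inner_right]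
    exact Finset.sum_congr rfl fun i _ => by rw [hP]; ring
  · rw [hPxy, ← b.sum_sq_inner_right, Finset.mul_sum]
    refine Finset.sum_le_sum fun i _ => ?_
    have := hs (b i)
    rw [b.norm_eq_one, mul_one] at this
    rw [← sq]
    exact mul_le_mul_of_nonneg_right this (sq_nonneg _)

/-- If `R² - P²` is bounded by `η` as a quadratic form, `P ≥ s > 0` and `R ≥ 0`, then
`‖R - P‖ ≤ η / s`. Indeed, if `b` is a unit eigenvector of `R - P` for the eigenvalue `l`, then
`‖R b‖² - ‖P b‖² = l * (⟪R b, b⟫ + ⟪P b, b⟫)`, so that `s * |l| ≤ η`. -/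
theorem norm_sub_le_of_abs_norm_sq_sub_le {P R : V →ₗ[ℝ] V} (hP : P.IsSymmetric)
    (hR : R.IsSymmetric) {s η : ℝ} (hs : 0 < s) (hPs : ∀ x, s * ‖x‖ ^ 2 ≤ inner ℝ (P x) x)
    (hR0 : ∀ x, 0 ≤ inner ℝ (R x) x)
    (hη : ∀ x, |‖R x‖ ^ 2 - ‖P x‖ ^ 2| ≤ η * ‖x‖ ^ 2) (x : V) :
    s * ‖R x - P x‖ ≤ η * ‖x‖ := by
  have hQ : (R - P).IsSymmetric := hR.sub hP
  set b := hQ.eigenvectorBasis rfl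
  set l := hQ.eigenvalues rfl
  have happ : ∀ i, (R - P) (b i) = l i • b i := fun i => by
    simpa using hQ.apply_eigenvectorBasis rfl i
  have hl_le : ∀ i, s * |l i| ≤ η := fun i => by
    have h1 : ‖R (b i)‖ ^ 2 - ‖P (b i)‖ ^ 2
        = l i * (inner ℝ (R (b i)) (b i) + inner ℝ (P (b i)) (b i)) := by
      have h2 : R (b i) - P (b i) = l i • b i := happ i
      rw [← real_inner_self_eq_norm_sq, ← real_inner_self_eq_norm_sq, ← inner_add_left,
        ← inner_smul_right, ← h2, inner_sub_right, inner_add_left, inner_add_left,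
        real_inner_comm (R (b i)) (P (b i))]
      ring
    have h3 := hη (b i)
    have h4 := hPs (b i)
    have h5 := hR0 (b i)
    rw [h1, abs_mul, b.norm_eq_one] at h3
    rw [b.norm_eq_one] at h4
    have h6 : s ≤ |inner ℝ (R (b i)) (b i) + inner ℝ (P (b i)) (b i)| :=
      le_trans (by linarith) (le_abs_self _)
    calc s * |l i| = |l i| * s := mul_comm _ _
      _ ≤ |l i| * |inner ℝ (R (b i)) (b i) + inner ℝ (P (b i)) (b i)| :=
          mul_le_mul_of_nonneg_left h6 (abs_nonneg _)
      _ ≤ η := by linarith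
  by_cases hx : x = 0
  · simp [hx]
  have hη0 : 0 ≤ η := by
    have := (abs_nonneg _).trans (hη x)
    exact nonneg_of_mul_nonneg_left this (by positivity)
  refine abs_le_of_sq_le_sq' ?_ (by positivity) |>.2
  have hQx : ∀ i, inner ℝ (b i) (R x - P x) = l i * inner ℝ (b i) x := fun i => by
    rw [← LinearMap.sub_apply, ← hQ, happ, inner_smul_left]; simp
  rw [mul_pow, mul_pow, ← b.sum_sq_inner_right, ← b.sum_sq_inner_right x, Finset.mul_sum,
    Finset.mul_sum]
  refine Finset.sum_le_sum fun i _ => ?_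
  rw [hQx, mul_pow, ← mul_assoc]
  refine mul_le_mul_of_nonneg_right ?_ (sq_nonneg _)
  rw [← sq_abs (l i), ← mul_pow]
  exact pow_le_pow_left₀ (by positivity) (hl_le i) 2

/-- A Procrustes bound: if `M` is bounded below by `s` and the quadratic forms of `N* N` and `M* M`
differ by at most `η`, then some linear isometry `U` brings `U N` within `η / s` of `M`. No smallness
of `η` is needed, and `N` may be singular. -/
theorem exists_linearIsometry_norm_sub_le (M N : V →ₗ[ℝ] V) {s η : ℝ} (hs : 0 < s)
    (hM : ∀ x, s * ‖x‖ ≤ ‖M x‖) (hη : ∀ x, |‖N x‖ ^ 2 - ‖M x‖ ^ 2| ≤ η * ‖x‖ ^ 2) :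
    ∃ U : V →ₗᵢ[ℝ] V, ∀ x, s * ‖U (N x) - M x‖ ≤ η * ‖x‖ := by
  obtain ⟨P, hP, hPM, hPs⟩ := exists_isSymmetric_norm_eq M
  obtain ⟨R, hR, hRN, hRs⟩ := exists_isSymmetric_norm_eq N
  obtain ⟨U₁, hU₁⟩ := exists_linearIsometry_comp_eq N R fun x => (hRN x).symm
  obtain ⟨U₂, hU₂⟩ := exists_linearIsometry_comp_eq P M hPM
  refine ⟨U₂.comp U₁, fun x => ?_⟩
  rw [LinearIsometry.coe_comp, Function.comp_apply, hU₁, ← hU₂, ← map_sub, LinearIsometry.norm_map]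
  refine norm_sub_le_of_abs_norm_sq_sub_le hP hR hs (hPs s hM) (fun y => ?_) (fun y => ?_) x
  · simpa using hRs 0 (fun z => by simp) y
  · rw [hRN, hPM]; exact hη y

end Procrustes

/-! ### Linear combinations of families with nearby Gram matrices -/

section Gram

variable {V ι : Type*} [NormedAddCommGroup V] [InnerProductSpace ℝ V] [Fintype ι]

theorem abs_inner_sum_sub_inner_sum_le {p q : ι → V} {p' q' : V} {ε : ℝ}
    (h : ∀ i, |inner ℝ (p i) p' - inner ℝ (q i) q'| ≤ ε) (a : ι → ℝ) :
    |inner ℝ (∑ i, a i • p i) p' - inner ℝ (∑ i, a i • q i) q'| ≤ ε * ∑ i, |a i| := by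
  simp only [sum_inner, real_inner_smul_left]
  rw [← Finset.sum_sub_distrib, Finset.mul_sum]
  refine (Finset.abs_sum_le_sum_abs _ _).trans (Finset.sum_le_sum fun i _ => ?_)
  rw [← mul_sub, abs_mul, mul_comm]
  exact mul_le_mul_of_nonneg_right (h i) (abs_nonneg _)

theorem abs_norm_sum_sq_sub_norm_sum_sq_le {p q : ι → V} {ε : ℝ}
    (h : ∀ i j, |inner ℝ (p i) (p j) - inner ℝ (q i) (q j)| ≤ ε) (a : ι → ℝ) :
    |‖∑ i, a i • p i‖ ^ 2 - ‖∑ i, a i • q i‖ ^ 2| ≤ ε * (∑ i, |a i|) ^ 2 := by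
  rw [← real_inner_self_eq_norm_sq, ← real_inner_self_eq_norm_sq, sq, ← mul_assoc]
  refine abs_inner_sum_sub_inner_sum_le (fun i => ?_) a
  rw [real_inner_comm, real_inner_comm (∑ i, a i • q i)]
  exact abs_inner_sum_sub_inner_sum_le (fun j => h j i) a

end Gram

theorem EuclideanSpace.sq_sum_abs_le {n : ℕ} (z : EuclideanSpace ℝ (Fin n)) :
    (∑ i, |z i|) ^ 2 ≤ n * ‖z‖ ^ 2 := by
  rw [EuclideanSpace.norm_sq_eq]
  simpa using sq_sum_le_card_mul_sum_sq (s := Finset.univ) (f := fun i => |z i|)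

/-- The linear map of `ℝⁿ` that sends the `i`-th standard basis vector to `w i`. -/
def combination {n : ℕ} (w : Fin n → EuclideanSpace ℝ (Fin n)) :
    EuclideanSpace ℝ (Fin n) →ₗ[ℝ] EuclideanSpace ℝ (Fin n) :=
  Fintype.linearCombination ℝ w ∘ₗ (WithLp.linearEquiv 2 ℝ (Fin n → ℝ)).toLinearMap

theorem combination_apply {n : ℕ} (w : Fin n → EuclideanSpace ℝ (Fin n))
    (z : EuclideanSpace ℝ (Fin n)) : combination w z = ∑ i, z i • w i := by
  simp [combination, Fintype.linearCombination_apply]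

/-- Let `p` and `q` be `n`-point families whose quadratic forms differ by at most `n * ε`, with `q`
bounded below by `s`. A vector that is nearly orthogonal to all `p i`, and whose norm is of order `√ε`,
is then of norm `O(ε / s)`. If `p` is bounded below by `s / 2`, near-orthogonality gives this;
otherwise `s ^ 2 ≤ 2 * n * ε`, and then `√ε` is itself `O(ε / s)`. -/
theorem norm_le_of_nearly_orthogonal {n : ℕ} (hn : 0 < n)
    {p q : Fin n → EuclideanSpace ℝ (Fin n)} {p₀ : EuclideanSpace ℝ (Fin n)}
    {s ε : ℝ} (hs : 0 < s) (hε : 0 ≤ ε)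
    (hq : ∀ z, s * ‖z‖ ≤ ‖combination q z‖)
    (hpq : ∀ z, |‖combination p z‖ ^ 2 - ‖combination q z‖ ^ 2| ≤ n * ε * ‖z‖ ^ 2)
    {K : ℝ} (hK : 0 ≤ K) (h_sq : ‖p₀‖ ^ 2 ≤ ε * K ^ 2) (h_inner : ∀ i, |inner ℝ p₀ (p i)| ≤ ε * K) :
    s * ‖p₀‖ ≤ 2 * n * K * ε := by
  have hn1 : (1 : ℝ) ≤ n := by exact_mod_cast hn
  by_cases hN : ∀ z, s / 2 * ‖z‖ ≤ ‖combination p z‖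
  -- `p` is a basis: expand `p₀` in it and pair the expansion with `p₀`
  · have hinj : Function.Injective (combination p) := by
      rw [← LinearMap.ker_eq_bot, LinearMap.ker_eq_bot']
      intro z hz
      have := hN z
      rw [hz, norm_zero] at this
      by_contra h0
      have : 0 < s / 2 * ‖z‖ := by positivity
      linarith
    obtain ⟨z, hz⟩ := LinearMap.surjective_of_injective hinj p₀
    have h1 : ‖p₀‖ ^ 2 ≤ n * ‖z‖ * (ε * K) := by
      rw [← real_inner_self_eq_norm_sq]
      nth_rewrite 1 [← hz]
      rw [combination_apply, sum_inner]
      calc ∑ i, inner ℝ (z i • p i) p₀ ≤ ∑ i : Fin n, ‖z‖ * (ε * K) := by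
            refine Finset.sum_le_sum fun i _ => ?_
            rw [real_inner_smul_left, real_inner_comm]
            refine (le_abs_self _).trans ?_
            rw [abs_mul]
            exact mul_le_mul (PiLp.norm_apply_le z i) (h_inner i) (abs_nonneg _) (norm_nonneg _)
        _ = n * ‖z‖ * (ε * K) := by simp; ring
    have h2 := hN z
    rw [hz] at h2
    by_cases h0 : ‖p₀‖ = 0
    · rw [h0, mul_zero]; positivity
    have h3 : 0 < ‖p₀‖ := lt_of_le_of_ne (norm_nonneg _) (Ne.symm h0)
    refine le_of_mul_le_mul_right ?_ h3
    calc s * ‖p₀‖ * ‖p₀‖ = s * ‖p₀‖ ^ 2 := by ring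
      _ ≤ s * (n * ‖z‖ * (ε * K)) := mul_le_mul_of_nonneg_left h1 hs.le
      _ = (2 * n * K * ε) * (s / 2 * ‖z‖) := by ring
      _ ≤ (2 * n * K * ε) * ‖p₀‖ := mul_le_mul_of_nonneg_left h2 (by positivity)
  -- `p` is nearly degenerate, which bounds `s` by a multiple of `√ε`
  · push Not at hN
    obtain ⟨z, hz⟩ := hN
    have hz0 : 0 < ‖z‖ := by
      by_contra h
      have : ‖z‖ = 0 := le_antisymm (not_lt.1 h) (norm_nonneg _)
      rw [this, mul_zero] at hz
      exact absurd hz (not_lt.2 (norm_nonneg _))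
    have h1 := pow_le_pow_left₀ (by positivity) (hq z) 2
    have h2 := pow_le_pow_left₀ (by positivity) hz.le 2
    have h3 := (abs_le.1 (hpq z)).1
    have h4 : s ^ 2 ≤ 2 * n * ε := by
      refine le_of_mul_le_mul_right ?_ (pow_pos hz0 2)
      have : 0 ≤ n * ε * ‖z‖ ^ 2 := by positivity
      nlinarith
    refine abs_le_of_sq_le_sq' ?_ (by positivity) |>.2
    calc (s * ‖p₀‖) ^ 2 = s ^ 2 * ‖p₀‖ ^ 2 := by ring
      _ ≤ (2 * n * ε) * (ε * K ^ 2) := by gcongr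
      _ = (2 * n * 1) * (K ^ 2 * ε ^ 2) := by ring
      _ ≤ (2 * n * (2 * n)) * (K ^ 2 * ε ^ 2) := by gcongr; linarith
      _ = (2 * n * K * ε) ^ 2 := by ring

/-- If the Gram matrices of `u` and `v` differ entrywise by at most `ε`, and a frame `u ∘ b`, bounded
below by `s`, represents every `u x` with bounded coefficients, then a linear isometry brings `v`
uniformly within `O(ε / s)` of `u`. -/
theorem exists_linearIsometry_of_gram_close {X : Type*} {n : ℕ} (hn : 0 < n)
    {u v : X → EuclideanSpace ℝ (Fin n)} {s ε : ℝ} (hs : 0 < s) (hε : 0 ≤ ε)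
    (huv : ∀ x y, |inner ℝ (v x) (v y) - inner ℝ (u x) (u y)| ≤ ε) (b : Fin n → X)
    (hb : ∀ z, s * ‖z‖ ≤ ‖combination (u ∘ b) z‖)
    (hc : ∀ x, ∃ c : EuclideanSpace ℝ (Fin n), (∀ i, |c i| ≤ 2) ∧ combination (u ∘ b) c = u x) :
    ∃ U : EuclideanSpace ℝ (Fin n) →ₗᵢ[ℝ] EuclideanSpace ℝ (Fin n),
      ∀ x, s * ‖U (v x) - u x‖ ≤ (2 * n * (1 + 2 * n) + 2 * n ^ 2) * ε := by
  have hpq : ∀ z, |‖combination (v ∘ b) z‖ ^ 2 - ‖combination (u ∘ b) z‖ ^ 2|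
      ≤ n * ε * ‖z‖ ^ 2 := fun z => by
    rw [combination_apply, combination_apply]
    refine (abs_norm_sum_sq_sub_norm_sum_sq_le (fun i j => huv (b i) (b j)) z.ofLp).trans ?_
    rw [mul_comm (n : ℝ) ε, mul_assoc]
    exact mul_le_mul_of_nonneg_left (EuclideanSpace.sq_sum_abs_le z) hε
  obtain ⟨U, hU⟩ := exists_linearIsometry_norm_sub_le _ _ hs hb hpq
  refine ⟨U, fun x => ?_⟩
  obtain ⟨c, hc2, hcx⟩ := hc x
  have hsum : ∑ i, |c i| ≤ 2 * n := by
    refine (Finset.sum_le_sum fun i _ => hc2 i).trans ?_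
    simp [mul_comm]
  have hcn : ‖c‖ ≤ 2 * n := by
    refine le_trans ?_ hsum
    refine abs_le_of_sq_le_sq' ?_ (Finset.sum_nonneg fun i _ => abs_nonneg _) |>.2
    rw [EuclideanSpace.norm_sq_eq]
    simpa using Finset.sum_sq_le_sq_sum_of_nonneg (s := Finset.univ) (f := fun i => |c i|)
      (fun i _ => abs_nonneg _)
  -- The vector `w x - ∑ i, c i • w (b i)` is a combination of `w ∘ e` with coefficients `a`; it
  -- vanishes for `w = u`, hence has small norm and small inner products for `w = v`.
  let e : Option (Fin n) → X := fun o => o.elim x b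
  let a : Option (Fin n) → ℝ := fun o => o.elim 1 fun i => -c i
  have hcomb : ∀ w : X → EuclideanSpace ℝ (Fin n),
      ∑ o, a o • w (e o) = w x - combination (w ∘ b) c := fun w => by
    simp [a, e, Fintype.sum_option, combination_apply, sub_eq_add_neg]
  have ha : ∑ o, |a o| ≤ 1 + 2 * n := by
    simpa [a, Fintype.sum_option] using hsum
  have hw : s * ‖v x - combination (v ∘ b) c‖ ≤ 2 * n * (1 + 2 * n) * ε := by
    refine norm_le_of_nearly_orthogonal hn hs hε hb hpq (by positivity) ?_ fun i => ?_
    · have := abs_norm_sum_sq_sub_norm_sum_sq_le (fun i j => huv (e i) (e j)) a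
      rw [hcomb v, hcomb u, hcx, sub_self, norm_zero, zero_pow two_ne_zero, sub_zero,
        abs_of_nonneg (sq_nonneg _)] at this
      refine this.trans (mul_le_mul_of_nonneg_left ?_ hε)
      exact pow_le_pow_left₀ (Finset.sum_nonneg fun i _ => abs_nonneg _) ha 2
    · have := abs_inner_sum_sub_inner_sum_le (fun o => huv (e o) (b i)) a
      rw [hcomb v, hcomb u, hcx, sub_self, inner_zero_left, sub_zero] at this
      exact this.trans (mul_le_mul_of_nonneg_left ha hε)
  have hsplit : U (v x) - u x = U (v x - combination (v ∘ b) c)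
      + (U (combination (v ∘ b) c) - combination (u ∘ b) c) := by
    rw [map_sub, hcx]; abel
  calc s * ‖U (v x) - u x‖ ≤ s * ‖v x - combination (v ∘ b) c‖
        + s * ‖U (combination (v ∘ b) c) - combination (u ∘ b) c‖ := by
        rw [hsplit, ← mul_add, ← U.norm_map (v x - _)]
        exact mul_le_mul_of_nonneg_left (norm_add_le _ _) hs.le
    _ ≤ 2 * n * (1 + 2 * n) * ε + n * ε * (2 * n) :=
        add_le_add hw ((hU c).trans (mul_le_mul_of_nonneg_left hcn (by positivity)))
    _ = (2 * n * (1 + 2 * n) + 2 * n ^ 2) * ε := by ring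

/-! ### Frames of nearly maximal volume -/

section Frame

theorem LinearMap.mul_norm_le_of_adjoint {V : Type*} [NormedAddCommGroup V] [InnerProductSpace ℝ V]
    [FiniteDimensional ℝ V] (A : V →ₗ[ℝ] V) {s : ℝ} (hs : 0 < s)
    (hA : ∀ y, s * ‖y‖ ≤ ‖A.adjoint y‖) (z : V) : s * ‖z‖ ≤ ‖A z‖ := by
  have hinj : Function.Injective A.adjoint := by
    rw [← LinearMap.ker_eq_bot, LinearMap.ker_eq_bot']
    intro y hy
    have := hA y
    rw [hy, norm_zero] at this
    by_contra h0
    have : 0 < s * ‖y‖ := by positivity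
    linarith
  obtain ⟨y, rfl⟩ := LinearMap.surjective_of_injective hinj z
  set z := A.adjoint y
  by_cases h0 : ‖z‖ = 0
  · rw [h0, mul_zero]; positivity
  have hz : 0 < ‖z‖ := lt_of_le_of_ne (norm_nonneg _) (Ne.symm h0)
  refine le_of_mul_le_mul_right ?_ hz
  calc s * ‖z‖ * ‖z‖ = s * inner ℝ z (A.adjoint y) := by
        rw [real_inner_self_eq_norm_sq]; ring
    _ = s * inner ℝ (A z) y := by rw [LinearMap.adjoint_inner_right]
    _ ≤ s * (‖A z‖ * ‖y‖) := mul_le_mul_of_nonneg_left (real_inner_le_norm _ _) hs.le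
    _ = ‖A z‖ * (s * ‖y‖) := by ring
    _ ≤ ‖A z‖ * ‖z‖ := mul_le_mul_of_nonneg_left (hA y) (norm_nonneg _)

variable {X : Type*} {n : ℕ} {u : X → EuclideanSpace ℝ (Fin n)}

/-- A bounded spanning family contains `n` members in terms of which all others have coefficients in
`[-2, 2]`: take members whose determinant is more than half of the supremum. -/
theorem exists_frame (hu : Bornology.IsBounded (Set.range u))
    (hspan : Submodule.span ℝ (Set.range u) = ⊤) :
    ∃ b : Fin n → X, ∀ x, ∃ c : EuclideanSpace ℝ (Fin n),
      (∀ i, |c i| ≤ 2) ∧ combination (u ∘ b) c = u x := by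
  set e := EuclideanSpace.basisFun (Fin n) ℝ
  set S : Set ℝ := Set.range fun b : Fin n → X => |e.toBasis.det (u ∘ b)|
  -- Hadamard's inequality
  have hSb : BddAbove S := by
    obtain ⟨D, hD⟩ := hu.exists_norm_le
    refine ⟨∏ _i : Fin n, D, ?_⟩
    rintro _ ⟨b, rfl⟩
    have : Fact (finrank ℝ (EuclideanSpace ℝ (Fin n)) = n) := ⟨by simp⟩
    have h1 := e.toBasis.orientation.abs_volumeForm_apply_le (u ∘ b)
    rw [e.toBasis.orientation.volumeForm_robust e rfl] at h1
    exact h1.trans (Finset.prod_le_prod (fun _ _ => norm_nonneg _)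
      fun i _ => hD _ (Set.mem_range_self _))
  have hpos : 0 < sSup S := by
    obtain ⟨κ, a, -, ha, hli⟩ := exists_linearIndependent' ℝ u
    have ha' : ⊤ ≤ Submodule.span ℝ (Set.range (u ∘ a)) := by rw [ha, hspan]
    let B := Basis.mk hli ha'
    have : Fintype κ := FiniteDimensional.fintypeBasisIndex B
    have hcard : Fintype.card κ = n := by
      rw [← Module.finrank_eq_card_basis B]; simp
    let σ : κ ≃ Fin n := Fintype.equivFinOfCardEq hcard
    have hdet : e.toBasis.det (u ∘ (a ∘ σ.symm)) ≠ 0 := by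
      have := (e.toBasis.isUnit_det (B.reindex σ)).ne_zero
      have hB : ⇑(B.reindex σ) = u ∘ (a ∘ σ.symm) := by
        ext1 i; simp [B]
      rwa [hB] at this
    exact (abs_pos.2 hdet).trans_le (le_csSup hSb ⟨_, rfl⟩)
  have hne : S.Nonempty := by
    by_contra h
    rw [Set.not_nonempty_iff_eq_empty.1 h, Real.sSup_empty] at hpos
    exact lt_irrefl _ hpos
  obtain ⟨_, ⟨b, rfl⟩, hb⟩ := exists_lt_of_lt_csSup hne (half_lt_self hpos)
  have hdet0 : e.toBasis.det (u ∘ b) ≠ 0 := by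
    intro h
    simp only [h, abs_zero] at hb
    linarith
  obtain ⟨hli, hsp⟩ := (Basis.is_basis_iff_det e.toBasis).2 (isUnit_iff_ne_zero.2 hdet0)
  refine ⟨b, fun x => ⟨WithLp.toLp 2 fun i => (Basis.mk hli hsp.ge).coord i (u x),
    fun i => ?_, ?_⟩⟩
  · -- Cramer's rule: the coefficient is a quotient of two determinants of points of the family
    have h1 := LinearMap.congr_fun (e.toBasis.det_smul_mk_coord_eq_det_update hli hsp.ge i) (u x)
    have h2 : e.toBasis.det (u ∘ b) * (Basis.mk hli hsp.ge).coord i (u x)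
        = e.toBasis.det (u ∘ Function.update b i x) := by
      rw [Function.comp_update]
      exact h1
    have h3 : |e.toBasis.det (u ∘ Function.update b i x)| ≤ sSup S := le_csSup hSb ⟨_, rfl⟩
    rw [← h2, abs_mul] at h3
    refine le_of_mul_le_mul_left ?_ (abs_pos.2 hdet0)
    exact h3.trans (by linarith)
  · rw [combination_apply]
    simpa using (Basis.mk hli hsp.ge).sum_repr (u x)

/-- If a bounded family extends at least `t` in every direction, the frame of `exists_frame` is also
bounded below, by `t / (2 * n)`. -/
theorem exists_frame_of_forall_exists_le_abs_inner (hn : 0 < n)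
    (hu : Bornology.IsBounded (Set.range u)) {t : ℝ} (ht : 0 < t)
    (hut : ∀ y, ∃ x, t * ‖y‖ ≤ |inner ℝ (u x) y|) :
    ∃ b : Fin n → X, (∀ z, t / (2 * n) * ‖z‖ ≤ ‖combination (u ∘ b) z‖) ∧
      ∀ x, ∃ c : EuclideanSpace ℝ (Fin n),
        (∀ i, |c i| ≤ 2) ∧ combination (u ∘ b) c = u x := by
  have hspan : Submodule.span ℝ (Set.range u) = ⊤ := by
    rw [← Submodule.orthogonal_eq_bot_iff, Submodule.eq_bot_iff]
    intro y hy
    obtain ⟨x, hx⟩ := hut y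
    rw [Submodule.inner_right_of_mem_orthogonal
      (Submodule.subset_span (Set.mem_range_self x)) hy, abs_zero] at hx
    by_contra h0
    have : 0 < t * ‖y‖ := by positivity
    linarith
  obtain ⟨b, hb⟩ := exists_frame hu hspan
  have hn' : (0 : ℝ) < n := by exact_mod_cast hn
  refine ⟨b, LinearMap.mul_norm_le_of_adjoint _ (by positivity) fun y => ?_, hb⟩
  obtain ⟨x, hx⟩ := hut y
  obtain ⟨c, hc, hcx⟩ := hb x
  have h1 : |inner ℝ (u x) y| ≤ 2 * n * ‖(combination (u ∘ b)).adjoint y‖ := by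
    rw [← hcx, ← LinearMap.adjoint_inner_right, PiLp.inner_apply]
    calc |∑ i, inner ℝ (c i) ((combination (u ∘ b)).adjoint y i)|
        ≤ ∑ i, |inner ℝ (c i) ((combination (u ∘ b)).adjoint y i)| :=
          Finset.abs_sum_le_sum_abs _ _
      _ ≤ ∑ _i : Fin n, 2 * ‖(combination (u ∘ b)).adjoint y‖ := by
          refine Finset.sum_le_sum fun i _ => ?_
          refine (abs_real_inner_le_norm _ _).trans ?_
          exact mul_le_mul (hc i) (PiLp.norm_apply_le _ i) (norm_nonneg _) zero_le_two
      _ = 2 * n * ‖(combination (u ∘ b)).adjoint y‖ := by simp; ring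
  rw [div_mul_eq_mul_div, div_le_iff₀ (by positivity), mul_comm _ (2 * (n : ℝ))]
  exact hx.trans h1

end Frame

/-! ### Thickness -/

section Thickness

variable {X : Type*} {n : ℕ} {f : X → EuclideanSpace ℝ (Fin n)} {θ : ℝ}

theorem dimension_pos_of_thickness_pos {A : Set (EuclideanSpace ℝ (Fin n))}
    (hA : 0 < TripletEmbedding.thickness A) : 0 < n := by
  rcases Nat.eq_zero_or_pos n with rfl | hn
  · have : IsEmpty (Metric.sphere (0 : EuclideanSpace ℝ (Fin 0)) 1) :=
      ⟨fun e => by simpa [Subsingleton.elim e.1 0] using e.2⟩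
    simp [TripletEmbedding.thickness, Real.iInf_of_isEmpty] at hA
  · exact hn

theorem nonempty_of_thickness_pos {A : Set (EuclideanSpace ℝ (Fin n))}
    (hA : 0 < TripletEmbedding.thickness A) : A.Nonempty := by
  by_contra h
  rw [Set.not_nonempty_iff_eq_empty] at h
  simp [TripletEmbedding.thickness, h, Real.iInf_const_zero] at hA

/-- A set of thickness at least `θ` extends, as seen from any of its points, at least `θ / 4` in every
direction, up to sign. -/
theorem exists_le_abs_inner_of_le_thickness (hθ : 0 < θ)
    (hf : θ ≤ TripletEmbedding.thickness (Set.range f)) (x₀ : X) (y : EuclideanSpace ℝ (Fin n)) :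
    ∃ x, θ / 4 * ‖y‖ ≤ |inner ℝ (f x - f x₀) y| := by
  by_contra! h
  have hy : 0 < ‖y‖ := by
    have := h x₀
    rw [sub_self, inner_zero_left, abs_zero] at this
    exact (pos_iff_pos_of_mul_pos this).1 (by positivity)
  let e : Metric.sphere (0 : EuclideanSpace ℝ (Fin n)) 1 :=
    ⟨‖y‖⁻¹ • y, by simp [norm_smul, hy.ne']⟩
  have he : ∀ x, |inner ℝ (f x - f x₀) (e : EuclideanSpace ℝ (Fin n))| ≤ θ / 4 := fun x => by
    change |inner ℝ (f x - f x₀) (‖y‖⁻¹ • y)| ≤ θ / 4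
    rw [real_inner_smul_right, abs_mul, abs_of_pos (inv_pos.2 hy), inv_mul_le_iff₀ hy, mul_comm]
    exact (h x).le
  have h1 : TripletEmbedding.thickness (Set.range f) ≤
      Metric.diam ((fun x => inner ℝ x (e : EuclideanSpace ℝ (Fin n))) '' Set.range f) :=
    ciInf_le ⟨0, by rintro _ ⟨_, rfl⟩; exact Metric.diam_nonneg⟩ e
  have h2 : Metric.diam ((fun x => inner ℝ x (e : EuclideanSpace ℝ (Fin n))) '' Set.range f)
      ≤ θ / 2 := by
    refine Metric.diam_le_of_forall_dist_le (by positivity) ?_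
    rintro _ ⟨_, ⟨x, rfl⟩, rfl⟩ _ ⟨_, ⟨x', rfl⟩, rfl⟩
    have h3 := he x
    have h4 := he x'
    rw [inner_sub_left] at h3 h4
    rw [Real.dist_eq]
    rw [abs_le] at h3 h4 ⊢
    constructor <;> linarith
  linarith

end Thickness

/-! ### Isometric approximation of thick sets -/

section Rigidity

variable {V : Type*} [NormedAddCommGroup V] [InnerProductSpace ℝ V]

/-- Nearly equal side lengths give nearly equal inner products, by polarization. The hypothesis `δ ≤ D`
makes the bound linear in `δ`. -/
theorem abs_inner_sub_inner_le_of_abs_norm_sub_le {a b a' b' : V} {D δ : ℝ}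
    (hD : ‖a‖ ≤ D) (hD' : ‖b‖ ≤ D) (hD'' : ‖a - b‖ ≤ D) (hδD : δ ≤ D)
    (ha : |‖a‖ - ‖a'‖| ≤ δ) (hb : |‖b‖ - ‖b'‖| ≤ δ) (hab : |‖a - b‖ - ‖a' - b'‖| ≤ δ) :
    |inner ℝ a' b' - inner ℝ a b| ≤ 9 / 2 * (δ * D) := by
  have key : ∀ p q : ℝ, 0 ≤ p → 0 ≤ q → p ≤ D → |p - q| ≤ δ → |p * p - q * q| ≤ 3 * (δ * D) := by
    intro p q hp hq hpD hpq
    have h1 : p * p - q * q = (p - q) * (p + q) := by ring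
    have h2 : |p + q| ≤ 3 * D := by
      rw [abs_of_nonneg (by positivity)]
      have := (abs_le.1 hpq).1
      linarith
    rw [h1, abs_mul]
    calc |p - q| * |p + q| ≤ δ * (3 * D) :=
          mul_le_mul hpq h2 (abs_nonneg _) ((abs_nonneg _).trans hpq)
      _ = 3 * (δ * D) := by ring
  have h1 := abs_le.1 (key _ _ (norm_nonneg a) (norm_nonneg a') hD ha)
  have h2 := abs_le.1 (key _ _ (norm_nonneg b) (norm_nonneg b') hD' hb)
  have h3 := abs_le.1 (key _ _ (norm_nonneg (a - b)) (norm_nonneg (a' - b')) hD'' hab)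
  rw [real_inner_eq_norm_mul_self_add_norm_mul_self_sub_norm_sub_mul_self_div_two a' b',
    real_inner_eq_norm_mul_self_add_norm_mul_self_sub_norm_sub_mul_self_div_two a b, abs_le]
  constructor <;> linarith

/-- The dimensional constant of `exists_linearIsometry_of_abs_norm_sub_le`: the first summand comes from
the frame argument when the distortion is at most `D`, and `12` covers larger distortions. -/
def isometricApproximationConst (n : ℕ) : ℝ :=
  36 * n * (2 * n * (1 + 2 * n) + 2 * n ^ 2) + 12

theorem isometricApproximationConst_pos (n : ℕ) : 0 < isometricApproximationConst n := by
  unfold isometricApproximationConst; positivity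

/-- The diameter is at least the thickness. The factor `1 / 4`, harmless for the purpose at hand, lets
this follow from `exists_le_abs_inner_of_le_thickness`. -/
theorem thickness_div_four_le {X : Type*} {n : ℕ} {f : X → EuclideanSpace ℝ (Fin n)} {D θ : ℝ}
    (hθ : 0 < θ) (hfD : ∀ x y, ‖f x - f y‖ ≤ D)
    (hf : θ ≤ TripletEmbedding.thickness (Set.range f)) : θ / 4 ≤ D := by
  have hn := dimension_pos_of_thickness_pos (hθ.trans_le hf)
  obtain ⟨_, x₀, rfl⟩ := nonempty_of_thickness_pos (hθ.trans_le hf)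
  set y : EuclideanSpace ℝ (Fin n) := EuclideanSpace.single ⟨0, hn⟩ (1 : ℝ)
  have hy : ‖y‖ = 1 := by simp [y]
  obtain ⟨x, hx⟩ := exists_le_abs_inner_of_le_thickness hθ hf x₀ y
  have := abs_real_inner_le_norm (f x - f x₀) y
  rw [hy, mul_one] at hx this
  exact hx.trans (this.trans (hfD x x₀))

/-- Isometric approximation: if all distances in the families `f` and `g` agree up to `δ`, and `f` has
diameter at most `D` and thickness at least `θ`, then a rigid motion brings `g` uniformly within a
dimensional multiple of `D * δ / θ` of `f`. -/
theorem exists_linearIsometry_of_abs_norm_sub_le {X : Type*} {n : ℕ}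
    {f g : X → EuclideanSpace ℝ (Fin n)} {D θ δ : ℝ} (hθ : 0 < θ) (hfD : ∀ x y, ‖f x - f y‖ ≤ D)
    (hf : θ ≤ TripletEmbedding.thickness (Set.range f))
    (hfg : ∀ x y, |‖f x - f y‖ - ‖g x - g y‖| ≤ δ) (x₀ : X) :
    ∃ U : EuclideanSpace ℝ (Fin n) →ₗᵢ[ℝ] EuclideanSpace ℝ (Fin n), ∀ x,
      ‖U (g x - g x₀) - (f x - f x₀)‖ ≤ isometricApproximationConst n * D / θ * δ := by
  have hn := dimension_pos_of_thickness_pos (hθ.trans_le hf)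
  have hn' : (0 : ℝ) < n := by exact_mod_cast hn
  have hD : θ / 4 ≤ D := thickness_div_four_le hθ hfD hf
  have hD0 : 0 < D := by linarith
  have hδ : 0 ≤ δ := (abs_nonneg _).trans (hfg x₀ x₀)
  set K : ℝ := 2 * n * (1 + 2 * n) + 2 * n ^ 2 with hK
  have hK0 : 0 ≤ K := by positivity
  rcases le_total δ D with hδD | hδD
  · have hub : Bornology.IsBounded (Set.range fun x => f x - f x₀) := by
      refine isBounded_iff_forall_norm_le.2 ⟨D, ?_⟩
      rintro _ ⟨x, rfl⟩
      exact hfD x x₀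
    obtain ⟨b, hb, hc⟩ := exists_frame_of_forall_exists_le_abs_inner hn hub
      (by positivity) (exists_le_abs_inner_of_le_thickness hθ hf x₀)
    obtain ⟨U, hU⟩ := exists_linearIsometry_of_gram_close (v := fun x => g x - g x₀)
      (ε := 9 / 2 * (δ * D)) hn (by positivity) (by positivity)
      (fun x y => abs_inner_sub_inner_le_of_abs_norm_sub_le (hfD x x₀) (hfD y x₀)
        (by simpa using hfD x y) hδD (hfg x x₀) (hfg y x₀) (by simpa using hfg x y)) b hb hc
    refine ⟨U, fun x => ?_⟩
    have h1 := hU x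
    have h2 : ‖U (g x - g x₀) - (f x - f x₀)‖ ≤ 36 * n * K * D / θ * δ := by
      refine le_of_mul_le_mul_left (h1.trans (le_of_eq ?_))
        (show 0 < θ / 4 / (2 * n) by positivity)
      rw [← hK]
      field_simp
      ring
    refine h2.trans ?_
    rw [isometricApproximationConst, ← hK]
    gcongr
    linarith
  -- For `D ≤ δ` all points lie within `O(δ)`, and `δ ≤ 4 * D / θ * δ`.
  · refine ⟨LinearIsometry.id, fun x => ?_⟩
    have h1 := (abs_le.1 (hfg x x₀)).1
    have h2 := hfD x x₀
    have h3 : 12 * δ * (θ / 4) ≤ 12 * δ * D := by gcongr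
    calc ‖LinearIsometry.id (g x - g x₀) - (f x - f x₀)‖ ≤ ‖g x - g x₀‖ + ‖f x - f x₀‖ :=
          norm_sub_le _ _
      _ ≤ 3 * δ := by linarith
      _ ≤ 12 * D / θ * δ := by
          rw [div_mul_eq_mul_div, le_div_iff₀ hθ]; linarith
      _ ≤ isometricApproximationConst n * D / θ * δ := by
          rw [isometricApproximationConst]
          gcongr
          linarith [show 0 ≤ 36 * n * (2 * n * (1 + 2 * n) + 2 * (n : ℝ) ^ 2) by positivity]

end Rigidity

/-! ### Triplet-separated functions -/

section TripletSeparated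

open TripletEmbedding

variable {X Y : Type*} {n : ℕ} {h : X → Y} {f g : X → EuclideanSpace ℝ (Fin n)}

/-- Triplet separation in terms of points of `X`. Surjectivity of `h` says that the classes are
non-empty. -/
theorem mem_tripletSeparated_iff :
    g ∈ tripletSeparated h n ↔ (Function.Surjective h ∧
      ∀ x y z, h x = h y → h x ≠ h z → ‖g x - g y‖ ≤ ‖g x - g z‖) := by
  constructor
  · rintro ⟨h1, h2⟩
    refine ⟨fun i => ?_, fun x y z hxy hxz => ?_⟩
    · obtain ⟨_, x, hx, rfl⟩ := h1 i
      exact ⟨x, hx⟩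
    · exact h2 _ _ hxz _ ⟨x, rfl, rfl⟩ _ ⟨y, hxy.symm, rfl⟩ _ ⟨z, rfl, rfl⟩
  · rintro ⟨h1, h2⟩
    refine ⟨fun i => ?_, ?_⟩
    · obtain ⟨x, hx⟩ := h1 i
      exact ⟨_, x, hx, rfl⟩
    · rintro i j hij _ ⟨x, hx, rfl⟩ _ ⟨y, hy, rfl⟩ _ ⟨z, hz, rfl⟩
      obtain rfl : h x = i := hx
      obtain rfl : h z = j := hz
      exact h2 x y z (Eq.symm hy) hij

theorem linearIsometry_comp_mem_tripletSeparated (hg : g ∈ tripletSeparated h n)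
    (U : EuclideanSpace ℝ (Fin n) →ₗᵢ[ℝ] EuclideanSpace ℝ (Fin n))
    (p q : EuclideanSpace ℝ (Fin n)) :
    (fun x => p + U (g x - q)) ∈ tripletSeparated h n := by
  rw [mem_tripletSeparated_iff] at hg ⊢
  refine ⟨hg.1, fun x y z hxy hxz => ?_⟩
  simpa [← map_sub] using hg.2 x y z hxy hxz

theorem dHaus_le_of_forall_norm_sub_le {r : ℝ} (hfg : ∀ x, ‖f x - g x‖ ≤ r) :
    dHaus h f g ≤ ENNReal.ofReal r := by
  have h1 : ∀ x, edist (f x) (g x) ≤ ENNReal.ofReal r := fun x => by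
    rw [edist_dist, dist_eq_norm]
    exact ENNReal.ofReal_le_ofReal (hfg x)
  refine iSup_le fun i => Metric.hausdorffEDist_le_of_mem_edist ?_ ?_
  · rintro _ ⟨x, hx, rfl⟩
    exact ⟨_, ⟨x, hx, rfl⟩, h1 x⟩
  · rintro _ ⟨x, hx, rfl⟩
    exact ⟨_, ⟨x, hx, rfl⟩, (edist_comm _ _).trans_le (h1 x)⟩

theorem dIso_le_two_mul {r : ℝ≥0∞} (hfg : ∀ x, edist (f x) (g x) ≤ r) : dIso f g ≤ 2 * r := by
  refine iSup₂_le fun x y => ?_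
  calc ENNReal.ofReal |‖f x - f y‖ - ‖g x - g y‖|
      ≤ ENNReal.ofReal (dist (f x) (g x) + dist (f y) (g y)) := by
        refine ENNReal.ofReal_le_ofReal ?_
        refine (abs_norm_sub_norm_le _ _).trans ?_
        rw [dist_eq_norm, dist_eq_norm,
          show f x - f y - (g x - g y) = f x - g x - (f y - g y) by abel]
        exact norm_sub_le _ _
    _ = edist (f x) (g x) + edist (f y) (g y) := by
        rw [ENNReal.ofReal_add dist_nonneg dist_nonneg, edist_dist, edist_dist]
    _ ≤ 2 * r := by
        rw [two_mul]
        exact add_le_add (hfg x) (hfg y)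

/-- Replacing `g x` by a nearby point `g (φ x)` of the same class keeps triplet separation, and turns
the Hausdorff bound between classes into a pointwise bound. -/
theorem dIsoSet_le_of_dHaus_lt (hg : g ∈ tripletSeparated h n) {r : ℝ≥0∞}
    (hfg : dHaus h f g < r) : dIsoSet f (tripletSeparated h n) ≤ 2 * r := by
  have h1 : ∀ x, ∃ x', h x' = h x ∧ edist (f x) (g x') < r := fun x => by
    have h2 : Metric.hausdorffEDist (classSet h f (h x)) (classSet h g (h x)) < r :=
      (le_iSup (fun i => Metric.hausdorffEDist (classSet h f i) (classSet h g i)) (h x)).trans_lt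
        hfg
    obtain ⟨_, ⟨x', hx', rfl⟩, hlt⟩ :=
      Metric.exists_edist_lt_of_hausdorffEDist_lt
        (show f x ∈ classSet h f (h x) from ⟨x, rfl, rfl⟩) h2
    exact ⟨x', hx', hlt⟩
  choose φ hφ hlt using h1
  refine (iInf₂_le (g ∘ φ) ?_).trans (dIso_le_two_mul fun x => (hlt x).le)
  rw [mem_tripletSeparated_iff] at hg ⊢
  refine ⟨hg.1, fun x y z hxy hxz => hg.2 _ _ _ ?_ ?_⟩
  · rw [hφ, hφ, hxy]
  · rwa [hφ, hφ]

theorem dIsoSet_le_two_mul_dHausSet :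
    dIsoSet f (tripletSeparated h n) ≤ 2 * dHausSet h f (tripletSeparated h n) := by
  rw [mul_comm, ← ENNReal.div_le_iff two_ne_zero ENNReal.ofNat_ne_top]
  refine le_iInf₂ fun g hg => le_of_forall_gt fun r hr => ?_
  obtain ⟨r', hr', hr'r⟩ := exists_between hr
  refine lt_of_le_of_lt ?_ hr'r
  rw [ENNReal.div_le_iff two_ne_zero ENNReal.ofNat_ne_top, mul_comm]
  exact dIsoSet_le_of_dHaus_lt hg hr'

theorem dHausSet_le_mul_dIsoSet {D θ : ℝ} (hθ : 0 < θ)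
    (hfb : Bornology.IsBounded (Set.range f)) (hfD : Metric.diam (Set.range f) ≤ D)
    (hf : θ ≤ thickness (Set.range f)) :
    dHausSet h f (tripletSeparated h n) ≤
      ENNReal.ofReal (isometricApproximationConst n * D / θ) *
        dIsoSet f (tripletSeparated h n) := by
  have hfD' : ∀ x y, ‖f x - f y‖ ≤ D := fun x y => by
    rw [← dist_eq_norm]
    exact (Metric.dist_le_diam_of_mem hfb (Set.mem_range_self x) (Set.mem_range_self y)).trans hfD
  have hD : θ / 4 ≤ D := thickness_div_four_le hθ hfD' hf
  have hc : 0 < isometricApproximationConst n * D / θ :=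
    div_pos (mul_pos (isometricApproximationConst_pos n) (by linarith)) hθ
  have hc' : ENNReal.ofReal (isometricApproximationConst n * D / θ) ≠ 0 := by simpa using hc
  obtain ⟨_, x₀, rfl⟩ := nonempty_of_thickness_pos (hθ.trans_le hf)
  rw [mul_comm, ← ENNReal.div_le_iff hc' ENNReal.ofReal_ne_top]
  refine le_iInf₂ fun g hg => ?_
  rw [ENNReal.div_le_iff hc' ENNReal.ofReal_ne_top, mul_comm]
  rcases eq_or_ne (dIso f g) ∞ with htop | htop
  · rw [htop, ENNReal.mul_top hc']
    exact le_top
  obtain ⟨U, hU⟩ := exists_linearIsometry_of_abs_norm_sub_le (g := g) (δ := (dIso f g).toReal)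
    hθ hfD' hf (fun x y => by
      rw [← ENNReal.ofReal_le_iff_le_toReal htop]
      exact le_iSup₂ (f := fun x y => ENNReal.ofReal |‖f x - f y‖ - ‖g x - g y‖|) x y) x₀
  refine (iInf₂_le _ (linearIsometry_comp_mem_tripletSeparated hg U (f x₀) (g x₀))).trans ?_
  refine (dHaus_le_of_forall_norm_sub_le (r := isometricApproximationConst n * D / θ *
    (dIso f g).toReal) fun x => ?_).trans ?_
  · rw [norm_sub_rev, show f x₀ + U (g x - g x₀) - f x = U (g x - g x₀) - (f x - f x₀) by abel]
    exact hU x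
  · rw [ENNReal.ofReal_mul hc.le, ENNReal.ofReal_toReal htop]

end TripletSeparated

theorem theorem2 (n : ℕ) :
    ∃ c : ℝ, 0 < c ∧
      ∀ (X : Type*) (Y : Type*) [Finite Y] (h : X → Y), Function.Surjective h →
      ∀ (D θ : ℝ), 0 < θ →
      ∀ f : X → EuclideanSpace ℝ (Fin n),
        Bornology.IsBounded (Set.range f) →
        Metric.diam (Set.range f) ≤ D →
        θ ≤ TripletEmbedding.thickness (Set.range f) →
          TripletEmbedding.dHausSet h f (TripletEmbedding.tripletSeparated h n) ≤
              ENNReal.ofReal (c * D / θ) *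
                TripletEmbedding.dIsoSet f (TripletEmbedding.tripletSeparated h n) ∧
          TripletEmbedding.dIsoSet f (TripletEmbedding.tripletSeparated h n) ≤
              2 * TripletEmbedding.dHausSet h f (TripletEmbedding.tripletSeparated h n) := by
  exact ⟨isometricApproximationConst n, isometricApproximationConst_pos n,
    fun _ _ _ _ _ _ _ hθ _ hfb hfD hf =>
      ⟨dHausSet_le_mul_dIsoSet hθ hfb hfD hf, dIsoSet_le_two_mul_dHausSet⟩⟩
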